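/- Let $d\ge 1$, let $H^0=L^2(\mathbb{T}^d)$ (real- or complex-valued functions) and let $H^2=H^2(\mathbb{T}^d)$ be the usual Sobolev space on the $d$-dimensional torus. Let $\{K^\lambda\}_{\lambda\in[0,1)}$ be bounded selfadjoint operators on $H^0$ such that $\sup_{\lambda}\|K^\lambda\|<\infty$ and, for every $\sigma\in[0,1)$ and every $u\in H^0$, $K^\lambda u\to K^\sigma u$ in $H^0$ as $\lambda\to\sigma$. Let $A^\lambda=-\Delta+K^\lambda$, an operator in $H^0$ with domain $H^2$. For each $n$ let $P_n$ be the orthogonal projection of $H^0$ onto the span of $n$ orthonormal eigenvectors associated with the first $n$ eigenvalues of $A^0$ (in increasing order, counting multiplicity), and let $A_n^\lambda=P_nA^\lambda P_n$. For an operator $T$, let $\mathrm{neg}(T)$ denote the number of negative eigenvalues of $T$, counting multiplicity. Suppose that $0$ is in the spectrum of $A^0$. Then there exist $\lambda^*\in(0,1]$ and $N\in\mathbb{N}$ such that $$\mathrm{neg}(A_n^\lambda)\ \ge\ \mathrm{neg}(A_n^0)\qquad\text{for all } 0<\lambda<\lambda^* \text{ and all } n>N.$$ -/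

import Mathlib

noncomputable section

namespace TorusSchrodinger

open MeasureTheory
open scoped ComplexConjugate

/-- The normalised Haar measure of the torus `(ℝ/ℤ)^d`. -/
abbrev torusMeasure (d : ℕ) : Measure (UnitAddTorus (Fin d)) :=
  Measure.pi fun _ => AddCircle.haarAddCircle

/-- The Hilbert space `H^0 = L²` of the `d`-dimensional torus, with scalars `𝕜 = ℝ` or `ℂ`. -/
abbrev H0 (𝕜 : Type*) [RCLike 𝕜] (d : ℕ) : Type _ := Lp 𝕜 2 (torusMeasure d)

section Sobolev

variable {𝕜 : Type*} [RCLike 𝕜] {d : ℕ}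

/-- The Fourier coefficient `∫ exp(-2πi m·x) f(x) dx` of an `L²` function on the torus. -/
def coeff (f : H0 𝕜 d) (m : Fin d → ℤ) : ℂ :=
  UnitAddTorus.mFourierCoeff (fun x => RCLike.map 𝕜 ℂ (f x)) m

/-- The number `|2πm|²`, i.e. the eigenvalue of `-Δ` on the character `exp(2πi m·x)`. -/
def freqSq (m : Fin d → ℤ) : ℝ := ∑ i, (2 * Real.pi * (m i : ℝ)) ^ 2

/-- The function `f`, seen as a complex-valued function. -/
def toComplex (f : H0 𝕜 d) : H0 ℂ d := (RCLike.map 𝕜 ℂ).compLp f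

lemma coeff_eq (f : H0 𝕜 d) (m : Fin d → ℤ) :
    coeff f m = UnitAddTorus.mFourierCoeff (toComplex f) m := by
  refine integral_congr_ae ?_
  have h := (RCLike.map 𝕜 ℂ).coeFn_compLp f
  change ∀ᵐ x ∂(torusMeasure d), _
  filter_upwards [h] with x hx
  simp only [toComplex, hx]

lemma coeff_eq_repr (f : H0 𝕜 d) (m : Fin d → ℤ) :
    coeff f m = UnitAddTorus.mFourierBasis.repr (toComplex f) m := by
  rw [coeff_eq]
  exact (UnitAddTorus.mFourierBasis_repr (toComplex f) m).symm

lemma map_mul (z w : 𝕜) :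
    RCLike.map 𝕜 ℂ (z * w) = RCLike.map 𝕜 ℂ z * RCLike.map 𝕜 ℂ w := by
  apply Complex.ext <;> simp

lemma map_injective : Function.Injective (RCLike.map 𝕜 ℂ) := by
  intro z w h
  have h1 := congrArg Complex.re h
  have h2 := congrArg Complex.im h
  rw [RCLike.map_apply, RCLike.map_apply] at h1 h2
  apply RCLike.ext
  · simpa using h1
  · simpa using h2

lemma toComplex_add (f g : H0 𝕜 d) : toComplex (f + g) = toComplex f + toComplex g :=
  ((RCLike.map 𝕜 ℂ).compLpₗ 2 (torusMeasure d)).map_add f g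

lemma toComplex_smul (c : 𝕜) (f : H0 𝕜 d) :
    toComplex (c • f) = RCLike.map 𝕜 ℂ c • toComplex f := by
  ext1
  filter_upwards [(RCLike.map 𝕜 ℂ).coeFn_compLp (c • f), (RCLike.map 𝕜 ℂ).coeFn_compLp f,
    Lp.coeFn_smul c f, Lp.coeFn_smul (RCLike.map 𝕜 ℂ c) (toComplex f)] with x h1 h2 h3 h4
  rw [h4, toComplex, h1, h3]
  simp only [Pi.smul_apply, smul_eq_mul, map_mul, toComplex, h2]

lemma toComplex_injective : Function.Injective (toComplex : H0 𝕜 d → H0 ℂ d) := by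
  intro f g h
  ext1
  have h' : (toComplex f : UnitAddTorus (Fin d) → ℂ) =ᵐ[torusMeasure d] toComplex g := by rw [h]
  filter_upwards [(RCLike.map 𝕜 ℂ).coeFn_compLp f, (RCLike.map 𝕜 ℂ).coeFn_compLp g, h']
    with x h1 h2 h3
  exact map_injective (h1.symm.trans (h3.trans h2))

lemma coeff_add (f g : H0 𝕜 d) (m : Fin d → ℤ) : coeff (f + g) m = coeff f m + coeff g m := by
  simp only [coeff_eq_repr, toComplex_add, map_add]
  rfl

lemma coeff_smul (c : 𝕜) (f : H0 𝕜 d) (m : Fin d → ℤ) :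
    coeff (c • f) m = RCLike.map 𝕜 ℂ c * coeff f m := by
  simp only [coeff_eq_repr, toComplex_smul, map_smul]
  rfl

lemma coeff_injective {f g : H0 𝕜 d} (h : ∀ m, coeff f m = coeff g m) : f = g := by
  apply toComplex_injective
  apply UnitAddTorus.mFourierBasis.repr.injective
  ext m
  simpa only [coeff_eq_repr] using h m

lemma freqSq_nonneg (m : Fin d → ℤ) : 0 ≤ freqSq m :=
  Finset.sum_nonneg fun _ _ => sq_nonneg _

lemma freqSq_neg (m : Fin d → ℤ) : freqSq (-m) = freqSq m := by
  simp [freqSq]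

variable (𝕜 d) in
/-- The Sobolev space `H^k` of the torus: those `f ∈ L²` with
`∑ₘ (1 + |2πm|²)^k |f̂(m)|² < ∞`. -/
def sobolev (k : ℕ) : Submodule 𝕜 (H0 𝕜 d) where
  carrier := {f | Summable fun m => (1 + freqSq m) ^ k * ‖coeff f m‖ ^ 2}
  zero_mem' := by
    have h (m : Fin d → ℤ) : coeff (0 : H0 𝕜 d) m = 0 := by
      simpa using coeff_smul (0 : 𝕜) (0 : H0 𝕜 d) m
    simp [h, summable_zero]
  add_mem' := by
    intro f g hf hg
    refine Summable.of_nonneg_of_le (fun m => ?_) (fun m => ?_) ((hf.add hg).mul_left 2)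
    · have := freqSq_nonneg m
      positivity
    · have h1 : ‖coeff (f + g) m‖ ^ 2 ≤ 2 * (‖coeff f m‖ ^ 2 + ‖coeff g m‖ ^ 2) := by
        rw [coeff_add]
        have := norm_add_le (coeff f m) (coeff g m)
        have h0 := norm_nonneg (coeff f m + coeff g m)
        nlinarith [sq_nonneg (‖coeff f m‖ - ‖coeff g m‖)]
      have h2 : 0 ≤ (1 + freqSq m) ^ k := by
        have := freqSq_nonneg m
        positivity
      nlinarith [mul_le_mul_of_nonneg_left h1 h2]
  smul_mem' := by
    intro c f hf
    refine (hf.mul_left (‖RCLike.map 𝕜 ℂ c‖ ^ 2)).congr fun m => ?_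
    rw [coeff_smul, norm_mul]
    ring

lemma coeff_conj (F : H0 ℂ d) (m : Fin d → ℤ) :
    coeff (Complex.conjCLE.toContinuousLinearMap.compLp F : H0 ℂ d) m = conj (coeff F (-m)) := by
  simp only [coeff, UnitAddTorus.mFourierCoeff]
  rw [← integral_conj]
  refine integral_congr_ae ?_
  change ∀ᵐ x ∂(torusMeasure d), _
  filter_upwards [Complex.conjCLE.toContinuousLinearMap.coeFn_compLp F] with x hx
  rw [hx, UnitAddTorus.mFourier_neg]
  simp

lemma toComplex_self (F : H0 ℂ d) : toComplex F = F := by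
  ext1
  filter_upwards [(RCLike.map ℂ ℂ).coeFn_compLp F] with x hx
  rw [toComplex, hx]
  simp

/-- Every `f ∈ H²` has a Laplacian in `L²`. -/
lemma exists_negLaplacian (f : sobolev 𝕜 d 2) :
    ∃ g : H0 𝕜 d, ∀ m, coeff g m = (freqSq m : ℂ) * coeff (f : H0 𝕜 d) m := by
  obtain ⟨f, hf⟩ := f
  have hmem : Memℓp (fun m : Fin d → ℤ => (freqSq m : ℂ) * coeff f m) 2 := by
    refine memℓp_gen ?_
    refine Summable.of_nonneg_of_le (fun m => by positivity) (fun m => ?_) hf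
    have h := freqSq_nonneg m
    simp only [ENNReal.toReal_ofNat, Real.rpow_ofNat, norm_mul, Complex.norm_real,
      Real.norm_eq_abs, mul_pow, sq_abs]
    gcongr
    linarith
  let c : lp (fun _ : Fin d → ℤ => ℂ) 2 := ⟨_, hmem⟩
  let G : H0 ℂ d := UnitAddTorus.mFourierBasis.repr.symm c
  have hG (m : Fin d → ℤ) : coeff G m = (freqSq m : ℂ) * coeff f m := by
    rw [coeff_eq_repr, toComplex_self]
    change UnitAddTorus.mFourierBasis.repr (UnitAddTorus.mFourierBasis.repr.symm c) m = _
    rw [LinearIsometryEquiv.apply_symm_apply]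
  refine ⟨(RCLike.map ℂ 𝕜).compLp G, fun m => ?_⟩
  suffices h : toComplex ((RCLike.map ℂ 𝕜).compLp G : H0 𝕜 d) = G by
    rw [coeff_eq, h, ← hG, coeff_eq, toComplex_self]
  rcases RCLike.I_eq_zero_or_im_I_eq_one (K := 𝕜) with hI | hI
  · have him (z : 𝕜) : RCLike.im z = 0 := by
      have := RCLike.re_add_im z
      rw [hI, mul_zero, add_zero] at this
      rw [← this, RCLike.ofReal_im]
    have hconj : (Complex.conjCLE.toContinuousLinearMap.compLp (toComplex f) : H0 ℂ d)
        = toComplex f := by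
      ext1
      filter_upwards [Complex.conjCLE.toContinuousLinearMap.coeFn_compLp (toComplex f),
        (RCLike.map 𝕜 ℂ).coeFn_compLp f] with x hx hy
      rw [hx, toComplex, hy]
      apply Complex.ext <;> simp [him]
    have hf' (m : Fin d → ℤ) : conj (coeff f (-m)) = coeff f m := by
      have := coeff_conj (toComplex f) m
      rw [hconj] at this
      simpa only [coeff_eq, toComplex_self] using this.symm
    have hGc : (Complex.conjCLE.toContinuousLinearMap.compLp G : H0 ℂ d) = G := by
      refine coeff_injective fun m => ?_
      rw [coeff_conj, hG, hG, _root_.map_mul, hf', Complex.conj_ofReal, freqSq_neg]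
    have hGc' : (Complex.conjCLE.toContinuousLinearMap.compLp G : H0 ℂ d)
        =ᵐ[torusMeasure d] G := by rw [hGc]
    ext1
    filter_upwards [Complex.conjCLE.toContinuousLinearMap.coeFn_compLp G, hGc',
      (RCLike.map ℂ 𝕜).coeFn_compLp G,
      (RCLike.map 𝕜 ℂ).coeFn_compLp ((RCLike.map ℂ 𝕜).compLp G : H0 𝕜 d)] with x h1 h2 h3 h4
    rw [toComplex, h4, h3]
    have h5 : (conj (G x) : ℂ) = G x := h1.symm.trans h2
    apply Complex.ext
    · simp [hI]
    · simp [hI, Complex.conj_eq_iff_im.mp h5]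
  · ext1
    filter_upwards [(RCLike.map ℂ 𝕜).coeFn_compLp G,
      (RCLike.map 𝕜 ℂ).coeFn_compLp ((RCLike.map ℂ 𝕜).compLp G : H0 𝕜 d)] with x h3 h4
    rw [toComplex, h4, h3]
    apply Complex.ext <;> simp [hI]

variable (𝕜 d) in
/-- The operator `-Δ` in `H^0` with domain `H^2`: the function `-Δf` has Fourier coefficients
`|2πm|² f̂(m)`. -/
def negLaplacian : H0 𝕜 d →ₗ.[𝕜] H0 𝕜 d where
  domain := sobolev 𝕜 d 2
  toFun :=
    { toFun := fun f => (exists_negLaplacian f).choose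
      map_add' := by
        intro f g
        refine coeff_injective fun m => ?_
        rw [coeff_add, (exists_negLaplacian (f + g)).choose_spec,
          (exists_negLaplacian f).choose_spec, (exists_negLaplacian g).choose_spec,
          Submodule.coe_add, coeff_add, mul_add]
      map_smul' := by
        intro c f
        refine coeff_injective fun m => ?_
        rw [RingHom.id_apply, coeff_smul, (exists_negLaplacian (c • f)).choose_spec,
          (exists_negLaplacian f).choose_spec, Submodule.coe_smul, coeff_smul]
        ring }

lemma coeff_negLaplacian (f : (negLaplacian 𝕜 d).domain) (m : Fin d → ℤ) :
    coeff (negLaplacian 𝕜 d f) m = (freqSq m : ℂ) * coeff (f : H0 𝕜 d) m :=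
  (exists_negLaplacian f).choose_spec m

/-- The Schrödinger operator `-Δ + K` in `H^0`, with domain `H^2`. -/
def schrodinger (K : H0 𝕜 d →L[𝕜] H0 𝕜 d) : H0 𝕜 d →ₗ.[𝕜] H0 𝕜 d :=
  (K : H0 𝕜 d →ₗ[𝕜] H0 𝕜 d) +ᵥ negLaplacian 𝕜 d

end Sobolev

section Operators

variable {𝕜 : Type*} [RCLike 𝕜] {H : Type*} [NormedAddCommGroup H] [InnerProductSpace 𝕜 H]

/-- The resolvent set `ρ(T)` of an operator `T` in `H`: the scalars `σ` for which `T - σ` maps the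
domain of `T` bijectively onto `H`, with a bounded inverse `R`. -/
def resolventSet (T : H →ₗ.[𝕜] H) : Set 𝕜 :=
  {σ | ∃ R : H →L[𝕜] H, (∀ u : T.domain, R (T u - σ • (u : H)) = u) ∧
    ∀ w : H, ∃ h : R w ∈ T.domain, T ⟨R w, h⟩ - σ • R w = w}

/-- The spectrum `Σ(T)`. -/
def spectrum (T : H →ₗ.[𝕜] H) : Set 𝕜 := (resolventSet T)ᶜ

/-- The space of all `u` in the domain of `T` with `T u = μ u`. -/
def eigenspace (T : H →ₗ.[𝕜] H) (μ : ℝ) : Submodule 𝕜 H where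
  carrier := {u | ∃ h : u ∈ T.domain, T ⟨u, h⟩ = (μ : 𝕜) • u}
  zero_mem' := ⟨T.domain.zero_mem, by
    rw [smul_zero]
    exact T.map_zero⟩
  add_mem' := by
    rintro u w ⟨hu, hu'⟩ ⟨hw, hw'⟩
    refine ⟨T.domain.add_mem hu hw, ?_⟩
    rw [smul_add, ← hu', ← hw']
    exact T.map_add ⟨u, hu⟩ ⟨w, hw⟩
  smul_mem' := by
    rintro c u ⟨hu, hu'⟩
    refine ⟨T.domain.smul_mem c hu, ?_⟩
    rw [smul_comm, ← hu']
    exact T.map_smul c ⟨u, hu⟩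

/-- The number of negative eigenvalues of `T`, counting multiplicity. Eigenspaces for different
eigenvalues are linearly independent, so this is the dimension of the sum of the eigenspaces for
the negative eigenvalues. -/
def neg (T : H →ₗ.[𝕜] H) : ℕ∞ :=
  Cardinal.toENat (Module.rank 𝕜 (⨆ μ : Set.Iio (0 : ℝ), eigenspace T μ : Submodule 𝕜 H))

/-- `P` is the orthogonal projection of `H` onto the span of eigenvectors `v 0, …, v (n - 1)` for
the first `n` eigenvalues `α 0 ≤ … ≤ α (n - 1)` of `T`, counting multiplicity: the `v i` are
orthonormal, and an eigenvector orthogonal to all of them has an eigenvalue that is no smaller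
than any of the `α i`. -/
def IsFirstEigenprojection (T : H →ₗ.[𝕜] H) (n : ℕ) (P : H →L[𝕜] H) : Prop :=
  ∃ (v : Fin n → H) (α : Fin n → ℝ),
    Orthonormal 𝕜 v ∧ Monotone α ∧ (∀ i, v i ∈ eigenspace T (α i)) ∧
    (∀ (β : ℝ) (w : H), w ∈ eigenspace T β → w ≠ 0 → (∀ i, inner 𝕜 (v i) w = 0) →
      ∀ i, α i ≤ β) ∧
    ∀ u, P u = ∑ i, inner 𝕜 (v i) u • v i

/-- The truncated operator `P T P`, on all `u` for which `P u` is in the domain of `T`. -/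
def truncate (P : H →L[𝕜] H) (T : H →ₗ.[𝕜] H) : H →ₗ.[𝕜] H where
  domain := T.domain.comap (P : H →ₗ[𝕜] H)
  toFun :=
    { toFun := fun u => P (T ⟨P u, u.2⟩)
      map_add' := by
        intro u w
        rw [← map_add, ← T.map_add]
        congr 2
        ext
        simp
      map_smul' := by
        intro c u
        rw [RingHom.id_apply, ← map_smul, ← T.map_smul]
        congr 2
        ext
        simp }

end Operators

end TorusSchrodinger

end

/-! The negative spectral space `V = negSpace A⁰` is finite-dimensional: a function whose
frequencies all satisfy `|2πm|² > ‖K⁰‖` has enough Dirichlet energy to absorb `K⁰`, and only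
finitely many frequencies remain (`NegDefOn.finiteDimensional`). Hence the form of `A⁰` is uniformly
negative on `V`. Strong convergence `K^λ → K⁰` is uniform on `V`, so the form of `A^λ` stays
negative definite there for small `λ` (`NegDefOn.eventually`).

The range of `P_n` is spanned by eigenvectors of `A⁰`, so negative eigenvectors of `A_n⁰` are
eigenvectors of `A⁰` and lie in `V` (`negSpace_truncate_le_negSpace`). Thus the form of `A^λ` is
negative definite on a space of dimension `neg(A_n⁰)` inside the range of `P_n`, and the variational
principle (`rank_le_neg_truncate`) gives the bound. Since `V` does not depend on `n`, neither does
`λ*`. -/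

noncomputable section

namespace TorusSchrodinger

open MeasureTheory
open scoped ComplexConjugate

/-! ### Symmetric operators and their negative eigenspaces. -/

section Symmetric

variable {𝕜 : Type*} [RCLike 𝕜] {H : Type*} [NormedAddCommGroup H] [InnerProductSpace 𝕜 H]

/-- `T` is symmetric on its domain. -/
def IsSymm (T : H →ₗ.[𝕜] H) : Prop :=
  ∀ u w : T.domain, inner 𝕜 (T u) (w : H) = inner 𝕜 (u : H) (T w)

/-- The quadratic form of `T` is negative definite on `W`, which lies in the domain of `T`. -/
def NegDefOn (T : H →ₗ.[𝕜] H) (W : Submodule 𝕜 H) : Prop :=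
  ∀ u ∈ W, u ≠ 0 → ∃ h : u ∈ T.domain, RCLike.re (inner 𝕜 (T ⟨u, h⟩) u) < 0

/-- The sum of the eigenspaces of `T` for the negative eigenvalues. -/
def negSpace (T : H →ₗ.[𝕜] H) : Submodule 𝕜 H :=
  ⨆ μ : Set.Iio (0 : ℝ), eigenspace T μ

lemma IsSymm.inner_eq_zero {T : H →ₗ.[𝕜] H} (hT : IsSymm T) {μ ν : ℝ} (hne : μ ≠ ν) {u w : H}
    (hu : u ∈ eigenspace T μ) (hw : w ∈ eigenspace T ν) : inner 𝕜 u w = 0 := by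
  obtain ⟨hu, hu'⟩ := hu
  obtain ⟨hw, hw'⟩ := hw
  have h := hT ⟨u, hu⟩ ⟨w, hw⟩
  simp only [hu', hw', inner_smul_left, inner_smul_right, RCLike.conj_ofReal] at h
  rw [← sub_eq_zero, ← sub_mul, mul_eq_zero] at h
  refine h.resolve_left fun h => hne ?_
  exact_mod_cast sub_eq_zero.mp h

lemma eigenspace_le_domain (T : H →ₗ.[𝕜] H) (μ : ℝ) : eigenspace T μ ≤ T.domain :=
  fun _ h => h.1

/-- The quadratic form of a symmetric operator is negative definite on the sum of its negative
eigenspaces. -/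
lemma IsSymm.negDefOn_negSpace {T : H →ₗ.[𝕜] H} (hT : IsSymm T) : NegDefOn T (negSpace T) := by
  classical
  intro u hu hne
  obtain ⟨f, rfl⟩ := (Submodule.mem_iSup_iff_exists_dfinsupp' _ u).mp hu
  have hdom (i : Set.Iio (0 : ℝ)) : (f i : H) ∈ T.domain := eigenspace_le_domain T i (f i).2
  have hsum : (f.sum fun _ x => (x : H)) = ∑ i ∈ f.support, (f i : H) := rfl
  rw [hsum] at hne ⊢
  have hmem : ∑ i ∈ f.support, (f i : H) ∈ T.domain := Submodule.sum_mem _ fun i _ => hdom i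
  refine ⟨hmem, ?_⟩
  have hTu : T ⟨∑ i ∈ f.support, (f i : H), hmem⟩ =
      ∑ i ∈ f.support, (((i : ℝ) : 𝕜) • (f i : H)) := by
    have h : (⟨∑ i ∈ f.support, (f i : H), hmem⟩ : T.domain) =
        ∑ i ∈ f.support, (⟨f i, hdom i⟩ : T.domain) := by
      ext; simp
    rw [h]
    change T.toFun _ = _
    rw [map_sum]
    exact Finset.sum_congr rfl fun i _ => (f i).2.choose_spec
  have key : RCLike.re (inner 𝕜 (∑ i ∈ f.support, (((i : ℝ) : 𝕜) • (f i : H)))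
      (∑ i ∈ f.support, (f i : H))) = ∑ i ∈ f.support, (i : ℝ) * ‖(f i : H)‖ ^ 2 := by
    rw [sum_inner, map_sum]
    refine Finset.sum_congr rfl fun i hi => ?_
    rw [inner_sum, Finset.sum_eq_single i]
    · rw [inner_smul_left, RCLike.conj_ofReal, RCLike.re_ofReal_mul, inner_self_eq_norm_sq]
    · intro j _ hj
      rw [inner_smul_left, hT.inner_eq_zero (fun h => hj (Subtype.ext h.symm)) (f i).2 (f j).2,
        mul_zero]
    · exact fun h => absurd hi h
  rw [hTu, key]
  refine Finset.sum_neg (fun i hi => ?_) ?_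
  · have : (f i : H) ≠ 0 := by simpa using hi
    exact mul_neg_of_neg_of_pos i.2 (by positivity)
  · by_contra h
    rw [Finset.not_nonempty_iff_eq_empty] at h
    simp [h] at hne

/-! ### Truncation to a finite-dimensional span and the variational principle. -/

section Projection

variable {n : ℕ} {v : Fin n → H} {P : H →L[𝕜] H}

lemma projection_mem_span (hP : ∀ u, P u = ∑ i, inner 𝕜 (v i) u • v i) (u : H) :
    P u ∈ Submodule.span 𝕜 (Set.range v) := by
  rw [hP]
  exact Submodule.sum_mem _ fun i _ =>
    Submodule.smul_mem _ _ (Submodule.subset_span (Set.mem_range_self i))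

lemma projection_eq_self (hv : Orthonormal 𝕜 v) (hP : ∀ u, P u = ∑ i, inner 𝕜 (v i) u • v i)
    {u : H} (hu : u ∈ Submodule.span 𝕜 (Set.range v)) : P u = u := by
  classical
  induction hu using Submodule.span_induction with
  | mem x hx =>
    obtain ⟨j, rfl⟩ := hx
    simp [hP, orthonormal_iff_ite.mp hv]
  | zero => simp
  | add x y _ _ hx hy => rw [map_add, hx, hy]
  | smul c x _ hx => rw [map_smul, hx]

lemma inner_projection_left (hP : ∀ u, P u = ∑ i, inner 𝕜 (v i) u • v i) (x y : H) :
    inner 𝕜 (P x) y = inner 𝕜 x (P y) := by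
  simp only [hP, sum_inner, inner_sum, inner_smul_left, inner_smul_right, inner_conj_symm]
  exact Finset.sum_congr rfl fun i _ => mul_comm _ _

lemma mem_domain_of_mem_span {T : H →ₗ.[𝕜] H} (hd : ∀ i, v i ∈ T.domain) {u : H}
    (hu : u ∈ Submodule.span 𝕜 (Set.range v)) : u ∈ T.domain :=
  Submodule.span_le.mpr (Set.range_subset_iff.mpr hd) hu

/-- Invariance of the span under `T`, the reason why truncating `T` by its own eigenvectors creates
no new negative eigenvectors. -/
lemma apply_mem_span {T : H →ₗ.[𝕜] H} {α : Fin n → ℝ} (hα : ∀ i, v i ∈ eigenspace T (α i))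
    {u : H} (hu : u ∈ Submodule.span 𝕜 (Set.range v)) :
    ∃ h : u ∈ T.domain, T ⟨u, h⟩ ∈ Submodule.span 𝕜 (Set.range v) := by
  induction hu using Submodule.span_induction with
  | mem x hx =>
    obtain ⟨j, rfl⟩ := hx
    obtain ⟨h, h'⟩ := hα j
    exact ⟨h, h' ▸ Submodule.smul_mem _ _ (Submodule.subset_span (Set.mem_range_self j))⟩
  | zero => exact ⟨T.domain.zero_mem, by
      have : T ⟨0, T.domain.zero_mem⟩ = 0 := T.map_zero
      rw [this]
      exact Submodule.zero_mem _⟩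
  | add x y _ _ hx hy =>
    obtain ⟨hx, hx'⟩ := hx
    obtain ⟨hy, hy'⟩ := hy
    refine ⟨T.domain.add_mem hx hy, ?_⟩
    have : T ⟨x + y, T.domain.add_mem hx hy⟩ = T ⟨x, hx⟩ + T ⟨y, hy⟩ := T.map_add ⟨x, hx⟩ ⟨y, hy⟩
    rw [this]
    exact Submodule.add_mem _ hx' hy'
  | smul c x _ hx =>
    obtain ⟨hx, hx'⟩ := hx
    refine ⟨T.domain.smul_mem c hx, ?_⟩
    have : T ⟨c • x, T.domain.smul_mem c hx⟩ = c • T ⟨x, hx⟩ := T.map_smul c ⟨x, hx⟩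
    rw [this]
    exact Submodule.smul_mem _ _ hx'

/-- Dividing the eigenvalue equation by `μ` exhibits `u` as a multiple of a value of `P`. The kernel
of `P` affects only the eigenvalue `0`. -/
lemma eigenspace_truncate_le_range (T : H →ₗ.[𝕜] H)
    (hP : ∀ u, P u = ∑ i, inner 𝕜 (v i) u • v i) {μ : ℝ} (hμ : μ ≠ 0) :
    eigenspace (truncate P T) μ ≤ Submodule.span 𝕜 (Set.range v) := by
  rintro u ⟨h, hu⟩
  have h1 : (μ : 𝕜) • u ∈ Submodule.span 𝕜 (Set.range v) := hu ▸ projection_mem_span hP _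
  exact (Submodule.smul_mem_iff _ (by exact_mod_cast hμ)).mp h1

lemma negSpace_truncate_le_span (T : H →ₗ.[𝕜] H)
    (hP : ∀ u, P u = ∑ i, inner 𝕜 (v i) u • v i) :
    negSpace (truncate P T) ≤ Submodule.span 𝕜 (Set.range v) :=
  iSup_le fun μ => eigenspace_truncate_le_range T hP (ne_of_lt μ.2)

lemma negSpace_truncate_le_negSpace {T : H →ₗ.[𝕜] H} (hv : Orthonormal 𝕜 v) {α : Fin n → ℝ}
    (hα : ∀ i, v i ∈ eigenspace T (α i)) (hP : ∀ u, P u = ∑ i, inner 𝕜 (v i) u • v i) :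
    negSpace (truncate P T) ≤ negSpace T := by
  refine iSup_le fun μ => le_trans ?_ (le_iSup _ μ)
  intro u hu
  have hspan := eigenspace_truncate_le_range T hP (ne_of_lt μ.2) hu
  obtain ⟨h, hu⟩ := hu
  obtain ⟨hd, hm⟩ := apply_mem_span hα hspan
  refine ⟨hd, ?_⟩
  rw [← projection_eq_self hv hP hm, ← hu]
  have hPu := projection_eq_self hv hP hspan
  change P (T ⟨u, hd⟩) = P (T ⟨P u, h⟩)
  congr 2
  exact Subtype.ext hPu.symm

/-- A subspace on which the quadratic form of `T` is negative definite bounds from below the number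
of negative eigenvalues of the truncation. -/
lemma rank_le_neg_truncate {T : H →ₗ.[𝕜] H} (hT : IsSymm T) (hv : Orthonormal 𝕜 v)
    (hd : ∀ i, v i ∈ T.domain) (hP : ∀ u, P u = ∑ i, inner 𝕜 (v i) u • v i)
    {W : Submodule 𝕜 H} (hW : W ≤ Submodule.span 𝕜 (Set.range v)) (hneg : NegDefOn T W) :
    Cardinal.toENat (Module.rank 𝕜 W) ≤ neg (truncate P T) := by
  change _ ≤ Cardinal.toENat (Module.rank 𝕜 (negSpace (truncate P T)))
  set E := Submodule.span 𝕜 (Set.range v) with hE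
  have : FiniteDimensional 𝕜 E := FiniteDimensional.span_of_finite 𝕜 (Set.finite_range v)
  have hdom (u : E) : (u : H) ∈ T.domain := mem_domain_of_mem_span hd u.2
  -- The compression of `T` to `E`: a symmetric endomorphism of a finite-dimensional space, to which
  -- the spectral theorem applies.
  let S : E →ₗ[𝕜] E :=
    { toFun := fun u => ⟨P (T ⟨u, hdom u⟩), projection_mem_span hP _⟩
      map_add' := fun u w => Subtype.ext <| by
        change P (T (⟨u, hdom u⟩ + ⟨w, hdom w⟩)) = _
        rw [T.map_add, map_add]
        rfl
      map_smul' := fun c u => Subtype.ext <| by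
        change P (T (c • ⟨u, hdom u⟩)) = _
        rw [T.map_smul, map_smul]
        rfl }
  have hSin (u w : E) : inner 𝕜 (S u) w = inner 𝕜 (T ⟨u, hdom u⟩) (w : H) := by
    change inner 𝕜 (P (T ⟨u, hdom u⟩)) (w : H) = _
    rw [inner_projection_left hP, projection_eq_self hv hP w.2]
  have hS : S.IsSymmetric := fun u w => by
    rw [hSin, ← inner_conj_symm u, hSin, inner_conj_symm]
    exact hT ⟨u, hdom u⟩ ⟨w, hdom w⟩
  have hNE := negSpace_truncate_le_span T hP
  have : FiniteDimensional 𝕜 (negSpace (truncate P T)) := Submodule.finiteDimensional_of_le hNE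
  have hmem {μ : ℝ} (hμ : μ < 0) {e : E} (he : S e = (μ : 𝕜) • e) :
      (e : H) ∈ negSpace (truncate P T) := by
    refine (le_iSup (fun μ : Set.Iio (0 : ℝ) => eigenspace (truncate P T) μ) ⟨μ, hμ⟩) ?_
    have hPe := projection_eq_self hv hP e.2
    have hPd : P (e : H) ∈ T.domain := hPe.symm ▸ hdom e
    refine ⟨hPd, ?_⟩
    have h1 : (S e : H) = (μ : 𝕜) • (e : H) := congrArg Subtype.val he
    rw [← h1]
    change P (T ⟨P e, hPd⟩) = P (T ⟨e, hdom e⟩)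
    congr 2
    exact Subtype.ext hPe
  let N := negSpace (truncate P T)
  -- Orthogonal projection onto `N` is injective on `W`: on vectors of `E` orthogonal to all
  -- negative eigenvectors the form is nonnegative.
  let Q : W →ₗ[𝕜] N := (N.orthogonalProjectionOnto : H →L[𝕜] N).toLinearMap ∘ₗ W.subtype
  refine Cardinal.toENat.monotone' (LinearMap.rank_le_of_injective Q ?_)
  rw [← LinearMap.ker_eq_bot, Submodule.eq_bot_iff]
  intro w hw
  by_contra hne
  have hperp : (w : H) ∈ Nᗮ := by
    rw [← Submodule.orthogonalProjectionOnto_eq_zero_iff]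
    exact hw
  obtain ⟨hwd, hlt⟩ := hneg w w.2 (by simpa using hne)
  let x : E := ⟨w, hW w.2⟩
  have h1 : RCLike.re (inner 𝕜 (S x) x) < 0 := by
    rw [hSin]
    exact hlt
  let b := hS.eigenvectorBasis rfl
  -- In the eigenbasis the form is `∑ μᵢ |⟨bᵢ, x⟩|²`. The terms with `μᵢ < 0` vanish because then
  -- `bᵢ` lies in `N`.
  have h2 := b.sum_inner_mul_inner (S x) x
  rw [← h2, map_sum] at h1
  refine absurd h1 (not_lt.mpr (Finset.sum_nonneg fun i _ => ?_))
  have h3 : S (b i) = ((hS.eigenvalues rfl i : ℝ) : 𝕜) • b i := hS.apply_eigenvectorBasis rfl i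
  rw [hS, h3, inner_smul_right, mul_assoc, RCLike.re_ofReal_mul]
  by_cases hμ : hS.eigenvalues rfl i < 0
  · have h4 : inner 𝕜 (b i) x = 0 := hperp _ (hmem hμ h3)
    rw [h4, mul_zero, map_zero, mul_zero]
  · refine mul_nonneg (not_lt.mp hμ) ?_
    rw [inner_mul_symm_re_eq_norm]
    exact norm_nonneg _

end Projection

end Symmetric

/-! ### Parseval's identity and the Dirichlet form. -/

section Fourier

variable {𝕜 : Type*} [RCLike 𝕜] {d : ℕ}

/-- Transfers inner products to complex `L²`, so that the complex Fourier basis serves real and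
complex scalars alike. -/
lemma map_inner (f g : H0 𝕜 d) :
    RCLike.map 𝕜 ℂ (inner 𝕜 f g) = inner ℂ (toComplex f) (toComplex g) := by
  rw [L2.inner_def, L2.inner_def, ← (RCLike.map 𝕜 ℂ).integral_comp_comm (L2.integrable_inner f g)]
  refine integral_congr_ae ?_
  change ∀ᵐ x ∂(torusMeasure d), _
  filter_upwards [(RCLike.map 𝕜 ℂ).coeFn_compLp f, (RCLike.map 𝕜 ℂ).coeFn_compLp g] with x hf hg
  rw [toComplex, toComplex, hf, hg]
  apply Complex.ext <;> simp [RCLike.inner_apply]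

lemma hasSum_coeff_inner (f g : H0 𝕜 d) :
    HasSum (fun m => conj (coeff f m) * coeff g m) (RCLike.map 𝕜 ℂ (inner 𝕜 f g)) := by
  rw [map_inner, ← UnitAddTorus.mFourierBasis.repr.inner_map_map]
  refine (lp.hasSum_inner _ _).congr_fun fun m => ?_
  rw [RCLike.inner_apply, coeff_eq_repr, coeff_eq_repr, mul_comm]

lemma hasSum_coeff_norm_sq (f : H0 𝕜 d) : HasSum (fun m => ‖coeff f m‖ ^ 2) (‖f‖ ^ 2) := by
  have h := Complex.hasSum_re (hasSum_coeff_inner f f)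
  have h1 : (RCLike.map 𝕜 ℂ (inner 𝕜 f f)).re = ‖f‖ ^ 2 := by
    rw [inner_self_eq_norm_sq_to_K, ← RCLike.ofReal_pow]
    simp only [RCLike.map_apply, RCLike.ofReal_re, RCLike.ofReal_im]
    simp [-Complex.ofReal_pow]
  rw [h1] at h
  refine h.congr_fun fun m => ?_
  rw [← Complex.normSq_eq_conj_mul_self, Complex.ofReal_re, Complex.normSq_eq_norm_sq]

lemma inner_negLaplacian_left (u w : (negLaplacian 𝕜 d).domain) :
    inner 𝕜 (negLaplacian 𝕜 d u) (w : H0 𝕜 d) = inner 𝕜 (u : H0 𝕜 d) (negLaplacian 𝕜 d w) := by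
  apply map_injective
  refine (hasSum_coeff_inner _ _).unique ((hasSum_coeff_inner _ _).congr_fun fun m => ?_)
  rw [coeff_negLaplacian, coeff_negLaplacian, _root_.map_mul, Complex.conj_ofReal]
  ring

lemma hasSum_coeff_negLaplacian (u : (negLaplacian 𝕜 d).domain) :
    HasSum (fun m => freqSq m * ‖coeff (u : H0 𝕜 d) m‖ ^ 2)
      (RCLike.re (inner 𝕜 (negLaplacian 𝕜 d u) (u : H0 𝕜 d))) := by
  have h := Complex.hasSum_re (hasSum_coeff_inner (negLaplacian 𝕜 d u) (u : H0 𝕜 d))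
  have h1 (z : 𝕜) : (RCLike.map 𝕜 ℂ z).re = RCLike.re z := by simp
  rw [h1] at h
  refine h.congr_fun fun m => ?_
  rw [coeff_negLaplacian, _root_.map_mul, Complex.conj_ofReal, mul_assoc,
    ← Complex.normSq_eq_conj_mul_self, ← Complex.ofReal_mul, Complex.ofReal_re,
    Complex.normSq_eq_norm_sq]

/-- A function without low frequencies has a large Dirichlet energy. -/
lemma mul_norm_sq_le_inner_negLaplacian (u : (negLaplacian 𝕜 d).domain) (C : ℝ)
    (h : ∀ m, freqSq m ≤ C → coeff (u : H0 𝕜 d) m = 0) :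
    C * ‖(u : H0 𝕜 d)‖ ^ 2 ≤ RCLike.re (inner 𝕜 (negLaplacian 𝕜 d u) (u : H0 𝕜 d)) := by
  refine hasSum_le (fun m => ?_) ((hasSum_coeff_norm_sq (u : H0 𝕜 d)).mul_left C)
    (hasSum_coeff_negLaplacian u)
  rcases le_or_gt (freqSq m) C with hm | hm
  · simp [h m hm]
  · gcongr

lemma finite_freqSq_le (C : ℝ) : {m : Fin d → ℤ | freqSq m ≤ C}.Finite := by
  refine (Set.finite_Icc (fun _ : Fin d => -⌈C⌉) (fun _ => ⌈C⌉)).subset fun m hm => ?_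
  have h (i : Fin d) : |m i| ≤ ⌈C⌉ := by
    have h1 : (2 * Real.pi * (m i : ℝ)) ^ 2 ≤ C :=
      (Finset.single_le_sum (f := fun i => (2 * Real.pi * (m i : ℝ)) ^ 2)
        (fun _ _ => sq_nonneg _) (Finset.mem_univ i)).trans hm
    have h2 : (m i : ℝ) ^ 2 ≤ (2 * Real.pi * (m i : ℝ)) ^ 2 := by
      rw [mul_pow]
      refine le_mul_of_one_le_left (sq_nonneg _) (one_le_pow₀ ?_)
      linarith [Real.pi_gt_three]
    -- Integrality turns the bound on the square into a bound on `|m i|` without square roots.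
    have h3 : |m i| ≤ (m i) ^ 2 := by
      rw [← Int.natCast_natAbs, ← Int.natAbs_sq]
      exact_mod_cast Nat.le_self_pow two_ne_zero _
    have h4 : (((m i) ^ 2 : ℤ) : ℝ) ≤ ⌈C⌉ := by
      push_cast
      exact (h2.trans h1).trans (Int.le_ceil C)
    exact h3.trans (by exact_mod_cast h4)
  exact ⟨fun i => (abs_le.mp (h i)).1, fun i => (abs_le.mp (h i)).2⟩

/-- A subspace on which only `0` lacks low frequencies is finite-dimensional. -/
lemma finiteDimensional_of_coeff (V : Submodule 𝕜 (H0 𝕜 d)) (C : ℝ)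
    (h : ∀ u ∈ V, (∀ m, freqSq m ≤ C → coeff u m = 0) → u = 0) : FiniteDimensional 𝕜 V := by
  have : Finite {m : Fin d → ℤ | freqSq m ≤ C} := finite_freqSq_le C
  -- Only real-linear, since `ℂ` carries no module structure over the abstract field `𝕜`.
  let F : V →ₗ[ℝ] ({m : Fin d → ℤ | freqSq m ≤ C} → ℂ) :=
    { toFun := fun u m => coeff (u : H0 𝕜 d) m
      map_add' := fun u w => by
        ext m
        exact coeff_add _ _ _
      map_smul' := fun c u => by
        ext m
        have h1 : ((c • u : V) : H0 𝕜 d) = (c : 𝕜) • (u : H0 𝕜 d) := by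
          rw [← RCLike.real_smul_eq_coe_smul (K := 𝕜)]
          rfl
        rw [h1, coeff_smul]
        simp [RCLike.map_apply] }
  have hF : Function.Injective F := by
    rw [← LinearMap.ker_eq_bot, Submodule.eq_bot_iff]
    intro u hu
    exact Subtype.ext (h u u.2 fun m hm => congrFun (LinearMap.mem_ker.mp hu) ⟨m, hm⟩)
  have : Module.Finite ℝ V := Module.Finite.of_injective F hF
  exact Module.Finite.of_restrictScalars_finite ℝ 𝕜 V

end Fourier

/-! ### Uniform estimates on finite-dimensional subspaces. -/

section Perturbation

variable {𝕜 : Type*} [RCLike 𝕜] {H : Type*} [NormedAddCommGroup H] [InnerProductSpace 𝕜 H]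

/-- On a finite-dimensional subspace, a negative definite form is uniformly so. -/
lemma NegDefOn.exists_bound {T : H →ₗ.[𝕜] H} {V : Submodule 𝕜 H} [FiniteDimensional 𝕜 V]
    (hV : NegDefOn T V) : ∃ δ > 0, ∀ u ∈ V, ∃ h : u ∈ T.domain,
      RCLike.re (inner 𝕜 (T ⟨u, h⟩) u) ≤ -δ * ‖u‖ ^ 2 := by
  have hle : V ≤ T.domain := fun u hu => by
    by_cases h : u = 0
    · exact h ▸ T.domain.zero_mem
    · exact (hV u hu h).1
  let A : V →ₗ[𝕜] H := T.toFun ∘ₗ Submodule.inclusion hle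
  have hA : Continuous A := A.continuous_of_finiteDimensional
  let q : V → ℝ := fun u => RCLike.re (inner 𝕜 (A u) (u : H))
  have hq : Continuous q := RCLike.continuous_re.comp (hA.inner continuous_subtype_val)
  have hqneg (u : V) (hu : u ≠ 0) : q u < 0 := (hV u u.2 (by simpa using hu)).2
  have hqsmul (c : ℝ) (u : V) : q ((c : 𝕜) • u) = c ^ 2 * q u := by
    simp only [q, map_smul, Submodule.coe_smul, inner_smul_left, inner_smul_right,
      RCLike.conj_ofReal, RCLike.re_ofReal_mul]
    ring
  have : ProperSpace V := FiniteDimensional.proper_rclike 𝕜 V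
  suffices h : ∃ δ > 0, ∀ u : V, ‖u‖ = 1 → q u ≤ -δ by
    obtain ⟨δ, hδ, h⟩ := h
    refine ⟨δ, hδ, fun u hu => ⟨hle hu, ?_⟩⟩
    change q ⟨u, hu⟩ ≤ _
    by_cases h0 : u = 0
    · subst h0
      have : q ⟨0, hu⟩ = 0 := by
        change RCLike.re (inner 𝕜 _ (0 : H)) = 0
        simp
      simp [this]
    · have hpos : 0 < ‖u‖ := norm_pos_iff.mpr h0
      have h1 := h (((‖u‖⁻¹ : ℝ) : 𝕜) • ⟨u, hu⟩) (by
        rw [norm_smul, RCLike.norm_ofReal, abs_of_pos (inv_pos.mpr hpos)]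
        exact inv_mul_cancel₀ hpos.ne')
      rw [hqsmul] at h1
      calc q ⟨u, hu⟩ = ‖u‖ ^ 2 * (‖u‖⁻¹ ^ 2 * q ⟨u, hu⟩) := by field_simp
        _ ≤ ‖u‖ ^ 2 * (-δ) := by gcongr
        _ = -δ * ‖u‖ ^ 2 := mul_comm _ _
  rcases (Metric.sphere (0 : V) 1).eq_empty_or_nonempty with he | hne
  -- The unit sphere is empty when `V` is trivial, and any `δ` will do.
  · refine ⟨1, one_pos, fun u hu => ?_⟩
    exact absurd (mem_sphere_zero_iff_norm.mpr hu) (he ▸ Set.notMem_empty u)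
  · obtain ⟨x, hx, hmax⟩ := (isCompact_sphere (0 : V) 1).exists_isMaxOn hne hq.continuousOn
    have hx0 : x ≠ 0 := ne_zero_of_mem_unit_sphere ⟨x, hx⟩
    -- The maximum of the form on the compact unit sphere is attained, hence strictly negative.
    refine ⟨-q x, neg_pos.mpr (hqneg x hx0), fun u hu => ?_⟩
    rw [neg_neg]
    exact hmax (mem_sphere_zero_iff_norm.mpr hu)

/-- Strong convergence of bounded operators is uniform on finite-dimensional subspaces. -/
lemma eventually_norm_sub_le {ι : Type*} {F : Filter ι} {K : ι → H →L[𝕜] H} {K₀ : H →L[𝕜] H}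
    (hK : ∀ u, Filter.Tendsto (fun l => K l u) F (nhds (K₀ u))) (V : Submodule 𝕜 H)
    [FiniteDimensional 𝕜 V] {ε : ℝ} (hε : 0 < ε) :
    ∀ᶠ l in F, ∀ u ∈ V, ‖K l u - K₀ u‖ ≤ ε * ‖u‖ := by
  let b := stdOrthonormalBasis 𝕜 V
  have h1 : Filter.Tendsto (fun l => ∑ i, ‖K l (b i : H) - K₀ (b i : H)‖) F (nhds 0) := by
    simpa using tendsto_finsetSum Finset.univ fun i _ =>
      tendsto_iff_norm_sub_tendsto_zero.mp (hK (b i : H))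
  filter_upwards [h1.eventually_lt_const hε] with l hl u hu
  have hsum : u = ∑ i, inner 𝕜 (b i) (⟨u, hu⟩ : V) • (b i : H) := by
    have := congrArg (Subtype.val : V → H) (b.sum_repr' ⟨u, hu⟩)
    simpa using this.symm
  calc ‖K l u - K₀ u‖
      = ‖∑ i, inner 𝕜 (b i) (⟨u, hu⟩ : V) • (K l (b i : H) - K₀ (b i : H))‖ := by
        congr 1
        conv_lhs => rw [hsum]
        simp only [map_sum, map_smul, smul_sub, Finset.sum_sub_distrib]
    _ ≤ ∑ i, ‖u‖ * ‖K l (b i : H) - K₀ (b i : H)‖ := by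
        refine norm_sum_le_of_le _ fun i _ => ?_
        rw [norm_smul]
        gcongr
        refine (norm_inner_le_norm _ _).trans ?_
        rw [b.norm_eq_one, one_mul]
        rfl
    _ = (∑ i, ‖K l (b i : H) - K₀ (b i : H)‖) * ‖u‖ := by rw [← Finset.mul_sum, mul_comm]
    _ ≤ ε * ‖u‖ := by gcongr

end Perturbation

/-! ### Negative definite subspaces of Schrödinger operators. -/

section Schrodinger

variable {𝕜 : Type*} [RCLike 𝕜] {d : ℕ}

lemma schrodinger_apply (K : H0 𝕜 d →L[𝕜] H0 𝕜 d) (u : (schrodinger K).domain) :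
    schrodinger K u = K u + negLaplacian 𝕜 d u := rfl

lemma isSymm_schrodinger {K : H0 𝕜 d →L[𝕜] H0 𝕜 d} (hK : IsSelfAdjoint K) :
    IsSymm (schrodinger K) := fun u w => by
  rw [schrodinger_apply, schrodinger_apply, inner_add_left, inner_add_right]
  exact congrArg₂ (· + ·) (hK.isSymmetric u w) (inner_negLaplacian_left u w)

lemma NegDefOn.finiteDimensional {K : H0 𝕜 d →L[𝕜] H0 𝕜 d} {V : Submodule 𝕜 (H0 𝕜 d)}
    (hV : NegDefOn (schrodinger K) V) : FiniteDimensional 𝕜 V := by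
  refine finiteDimensional_of_coeff V ‖K‖ fun u hu hc => ?_
  by_contra hne
  obtain ⟨h, hlt⟩ := hV u hu hne
  have h1 := mul_norm_sq_le_inner_negLaplacian ⟨u, h⟩ ‖K‖ hc
  rw [schrodinger_apply, inner_add_left, map_add] at hlt
  have h2 : |RCLike.re (inner 𝕜 (K u) u)| ≤ ‖K‖ * ‖u‖ ^ 2 :=
    calc |RCLike.re (inner 𝕜 (K u) u)| ≤ ‖K u‖ * ‖u‖ :=
          (RCLike.abs_re_le_norm _).trans (norm_inner_le_norm _ _)
      _ ≤ ‖K‖ * ‖u‖ * ‖u‖ := by gcongr; exact K.le_opNorm u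
      _ = ‖K‖ * ‖u‖ ^ 2 := by ring
  have h3 := (abs_le.mp h2).1
  refine absurd hlt (not_lt.mpr ?_)
  rw [← neg_add_cancel (‖K‖ * ‖u‖ ^ 2)]
  exact add_le_add h3 h1

/-- Negative definiteness persists under small perturbations in the strong topology. -/
lemma NegDefOn.eventually {ι : Type*} {F : Filter ι} {K : ι → H0 𝕜 d →L[𝕜] H0 𝕜 d}
    {K₀ : H0 𝕜 d →L[𝕜] H0 𝕜 d} (hK : ∀ u, Filter.Tendsto (fun l => K l u) F (nhds (K₀ u)))
    {V : Submodule 𝕜 (H0 𝕜 d)} (hV : NegDefOn (schrodinger K₀) V) :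
    ∀ᶠ l in F, NegDefOn (schrodinger (K l)) V := by
  have := hV.finiteDimensional
  obtain ⟨δ, hδ, hb⟩ := hV.exists_bound
  -- A perturbation of size `δ / 2` leaves the form at most `-(δ / 2) ‖u‖²`.
  filter_upwards [eventually_norm_sub_le hK V (half_pos hδ)] with l hl u hu hne
  obtain ⟨h, hle⟩ := hb u hu
  refine ⟨h, ?_⟩
  have hsplit : schrodinger (K l) ⟨u, h⟩ = schrodinger K₀ ⟨u, h⟩ + (K l u - K₀ u) := by
    rw [schrodinger_apply, schrodinger_apply]
    dsimp only
    abel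
  rw [hsplit, inner_add_left, map_add]
  have h1 : RCLike.re (inner 𝕜 (K l u - K₀ u) u) ≤ δ / 2 * ‖u‖ ^ 2 :=
    calc RCLike.re (inner 𝕜 (K l u - K₀ u) u) ≤ ‖K l u - K₀ u‖ * ‖u‖ :=
          re_inner_le_norm _ _
      _ ≤ δ / 2 * ‖u‖ * ‖u‖ := by gcongr; exact hl u hu
      _ = δ / 2 * ‖u‖ ^ 2 := by ring
  have h2 : 0 < δ * ‖u‖ ^ 2 := by positivity
  linarith

end Schrodinger

end TorusSchrodinger

end

theorem mainTheorem5 {𝕜 : Type*} [RCLike 𝕜] (d : ℕ)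
    (K : ℝ → TorusSchrodinger.H0 𝕜 d →L[𝕜] TorusSchrodinger.H0 𝕜 d)
    (hK_selfAdjoint : ∀ l ∈ Set.Ico (0 : ℝ) 1, IsSelfAdjoint (K l))
    (hK_bounded : ∃ C : ℝ, ∀ l ∈ Set.Ico (0 : ℝ) 1, ‖K l‖ ≤ C)
    (hK_strong : ∀ s ∈ Set.Ico (0 : ℝ) 1, ∀ u : TorusSchrodinger.H0 𝕜 d,
      Filter.Tendsto (fun l => K l u) (nhdsWithin s (Set.Ico (0 : ℝ) 1)) (nhds (K s u)))
    (P : ℕ → TorusSchrodinger.H0 𝕜 d →L[𝕜] TorusSchrodinger.H0 𝕜 d)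
    (hP : ∀ n, TorusSchrodinger.IsFirstEigenprojection
      (TorusSchrodinger.schrodinger (K 0)) n (P n))
    (h_spec : (0 : 𝕜) ∈ TorusSchrodinger.spectrum (TorusSchrodinger.schrodinger (K 0))) :
    ∃ lstar : ℝ, 0 < lstar ∧ lstar ≤ 1 ∧ ∃ N : ℕ, ∀ l : ℝ, 0 < l → l < lstar →
      ∀ n : ℕ, N < n →
        TorusSchrodinger.neg
            (TorusSchrodinger.truncate (P n) (TorusSchrodinger.schrodinger (K l))) ≥
          TorusSchrodinger.neg
            (TorusSchrodinger.truncate (P n) (TorusSchrodinger.schrodinger (K 0))) := by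
  have hsymm := TorusSchrodinger.isSymm_schrodinger (hK_selfAdjoint 0 ⟨le_rfl, one_pos⟩)
  have hev := hsymm.negDefOn_negSpace.eventually (hK_strong 0 ⟨le_rfl, one_pos⟩)
  obtain ⟨ε, hε, hsub⟩ := Metric.mem_nhdsWithin_iff.mp hev
  -- `N = 0` suffices: `ε` comes from the full space `negSpace A⁰`, which contains the negative
  -- space of every truncation.
  refine ⟨min ε 1, lt_min hε one_pos, min_le_right _ _, 0, fun l hl0 hl n _ => ?_⟩
  have hl1 : l ∈ Set.Ico (0 : ℝ) 1 := ⟨hl0.le, hl.trans_le (min_le_right _ _)⟩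
  have hneg : TorusSchrodinger.NegDefOn (TorusSchrodinger.schrodinger (K l)) _ :=
    hsub ⟨by simpa [abs_of_pos hl0] using hl.trans_le (min_le_left _ _), hl1⟩
  obtain ⟨v, α, hv, -, hα, -, hP⟩ := hP n
  refine TorusSchrodinger.rank_le_neg_truncate
    (TorusSchrodinger.isSymm_schrodinger (hK_selfAdjoint l hl1)) hv (fun i => (hα i).1) hP
    (TorusSchrodinger.negSpace_truncate_le_span _ hP) fun u hu hne => ?_
  exact hneg u (TorusSchrodinger.negSpace_truncate_le_negSpace hv hα hP hu) hne
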